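/- Let $N \ge 1$, let $\Omega \subset \mathbb{R}^N$ be a bounded open set with Lipschitz boundary, let $0 < a, b < \infty$, and let $g \in C(\partial\Omega)$ be the trace of some function in $W^{1,2}(\Omega)$. Put $$X_a^b(\Omega) = \{ f \in L^\infty(\Omega) : a \le f \le b \text{ a.e. in } \Omega \}.$$ Then for all $\mu, D \in X_a^b(\Omega)$ the boundary value problem $$-\nabla\cdot(D\nabla u) + \mu u = 0 \ \text{ in } \Omega, \qquad u|_{\partial\Omega} = g,$$ has exactly one weak solution $u = u(\mu,D)$, that is, exactly one $u \in W^{1,2}(\Omega)$ with trace $g$ on $\partial\Omega$ such that $$\int_\Omega D\,\nabla u\cdot\nabla v \,dx + \int_\Omega \mu\, u\, v\,dx = 0$$ for all $v \in W^{1,2}(\Omega)$ with vanishing trace. Moreover, the non-linear measurement operator $$\mathcal{E}\colon X_a^b(\Omega)^2 \to L^2(\Omega), \qquad \mathcal{E}(\mu,D) = \mu\, u(\mu,D),$$ is continuous when $X_a^b(\Omega)^2$ carries the topology of $L^2(\Omega)^2$, and it is also continuous when $X_a^b(\Omega)^2$ carries the topology of $L^1(\Omega)^2$; in both cases the target $L^2(\Omega)$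 carries its norm topology. -/

import Mathlib

open MeasureTheory Filter Topology
open scoped ENNReal NNReal ContDiff

noncomputable section

namespace QPAT

/-- The space `ℝ^N` with the Euclidean norm. -/
abbrev Space (N : ℕ) : Type := EuclideanSpace ℝ (Fin N)

/-- Bounded open sets with Lipschitz boundary: near each boundary point, after a rotation, `Ω` is
the region strictly above the graph of a Lipschitz function. Here `ν` is the "upward" direction,
`y - ⟪ν, y⟫ ν` is the projection of `y` onto the hyperplane orthogonal to `ν`, and `⟪ν, y⟫` is the
height of `y`. (Connectedness is not required.) -/
structure IsLipschitzDomain {N : ℕ} (Ω : Set (Space N)) : Prop where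
  isOpen : IsOpen Ω
  isBounded : Bornology.IsBounded Ω
  exists_graph : ∀ x ∈ frontier Ω, ∃ ν : Space N, ‖ν‖ = 1 ∧
    ∃ (K : ℝ≥0) (γ : Space N → ℝ), LipschitzWith K γ ∧
      ∃ U ∈ 𝓝 x, ∀ y ∈ U, (y ∈ Ω ↔ γ (y - (inner ℝ ν y) • ν) < inner ℝ ν y)

/-- `F` is the weak (distributional) gradient of `w` in `Ω`. -/
def HasWeakGradient {N : ℕ} (Ω : Set (Space N)) (w : Space N → ℝ) (F : Space N → Space N) : Prop :=
  ∀ φ : Space N → ℝ, ContDiff ℝ ∞ φ → HasCompactSupport φ → tsupport φ ⊆ Ω →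
    ∫ x in Ω, w x • gradient φ x = - ∫ x in Ω, φ x • F x

/-- `w` belongs to the Sobolev space `W^{1,2}(Ω)` and `F` is its weak gradient. -/
structure MemW12 {N : ℕ} (Ω : Set (Space N)) (w : Space N → ℝ) (F : Space N → Space N) : Prop where
  memLp : MemLp w 2 (volume.restrict Ω)
  memLp_gradient : MemLp F 2 (volume.restrict Ω)
  hasWeakGradient : HasWeakGradient Ω w F

/-- The surface measure `H^{N-1}` on the boundary of `Ω`. -/
def surfaceMeasure {N : ℕ} (Ω : Set (Space N)) : Measure (Space N) :=
  (Measure.hausdorffMeasure ((N : ℝ) - 1)).restrict (frontier Ω)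

/-- The function `w ∈ W^{1,2}(Ω)` has trace `g` on the boundary of `Ω`: it is the limit
in `W^{1,2}(Ω)` of functions `φ n` that are smooth up to the boundary and whose boundary values
converge to `g` in `L²(∂Ω)`. For a Lipschitz domain this is the graph of the trace operator
`W^{1,2}(Ω) → L²(∂Ω)`, the continuous extension of the restriction `φ ↦ φ|_{∂Ω}`. -/
def HasTrace {N : ℕ} (Ω : Set (Space N)) (w g : Space N → ℝ) : Prop :=
  ∃ F : Space N → Space N, MemW12 Ω w F ∧
    ∃ φ : ℕ → Space N → ℝ, (∀ n, ContDiff ℝ ∞ (φ n)) ∧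
      Tendsto (fun n => eLpNorm (fun x => φ n x - w x) 2 (volume.restrict Ω)) atTop (𝓝 0) ∧
      Tendsto (fun n => eLpNorm (fun x => gradient (φ n) x - F x) 2 (volume.restrict Ω))
        atTop (𝓝 0) ∧
      Tendsto (fun n => eLpNorm (fun x => φ n x - g x) 2 (surfaceMeasure Ω)) atTop (𝓝 0)

/-- `u ∈ W^{1,2}(Ω)` is a weak solution of `-∇·(D ∇u) + μ u = 0` in `Ω`, `u = g` on `∂Ω`. The test
functions are the elements of `W^{1,2}_0(Ω)`, that is, the functions in `W^{1,2}(Ω)` with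
vanishing trace. -/
def IsWeakSolution {N : ℕ} (Ω : Set (Space N)) (g μ D u : Space N → ℝ) : Prop :=
  HasTrace Ω u g ∧
    ∃ F : Space N → Space N, MemW12 Ω u F ∧
      ∀ (v : Space N → ℝ) (V : Space N → Space N), MemW12 Ω v V → HasTrace Ω v (fun _ => 0) →
        (∫ x in Ω, D x * inner ℝ (F x) (V x)) + ∫ x in Ω, μ x * u x * v x = 0

/-- The set `X_a^b(Ω)` of functions with `a ≤ f ≤ b` a.e. in `Ω`, as a subset of `L^p(Ω)`. -/
def admissible {N : ℕ} (Ω : Set (Space N)) (a b : ℝ) (p : ℝ≥0∞) :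
    Set (Lp ℝ p (volume.restrict Ω)) :=
  {f | ∀ᵐ x ∂(volume.restrict Ω), a ≤ f x ∧ f x ≤ b}

/-- The fluence `u(μ, D) ∈ L²(Ω)`: the weak solution of the diffusion equation with absorption
coefficient `μ`, diffusion coefficient `D` and boundary values `g`. -/
def fluence {N : ℕ} (Ω : Set (Space N)) (g μ D : Space N → ℝ) : Lp ℝ 2 (volume.restrict Ω) :=
  Classical.epsilon fun u : Lp ℝ 2 (volume.restrict Ω) => IsWeakSolution Ω g μ D u

theorem memLp_mul_of_mem_admissible {N : ℕ} {Ω : Set (Space N)} {a b : ℝ} {p : ℝ≥0∞}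
    {f : Lp ℝ p (volume.restrict Ω)} (hf : f ∈ admissible Ω a b p)
    (u : Lp ℝ 2 (volume.restrict Ω)) :
    MemLp (fun x => f x * u x) 2 (volume.restrict Ω) := by
  refine MemLp.of_le_mul (c := max |a| |b|) (Lp.memLp u)
    ((Lp.aestronglyMeasurable f).mul (Lp.aestronglyMeasurable u)) ?_
  have hf' : ∀ᵐ x ∂(volume.restrict Ω), a ≤ f x ∧ f x ≤ b := hf
  filter_upwards [hf'] with x hx
  rw [norm_mul]
  exact mul_le_mul_of_nonneg_right (abs_le_max_abs_abs hx.1 hx.2) (norm_nonneg _)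

/-- The measurement operator `E(μ, D) = μ u(μ, D)`, defined on `X_a^b(Ω)²`, considered as a subset
of `L^p(Ω)²`, with values in `L²(Ω)`. -/
def measurementOperator {N : ℕ} (Ω : Set (Space N)) (g : Space N → ℝ) (a b : ℝ) (p : ℝ≥0∞)
    (q : admissible Ω a b p × admissible Ω a b p) : Lp ℝ 2 (volume.restrict Ω) :=
  (memLp_mul_of_mem_admissible q.1.2 (fluence Ω g q.1.1 q.2.1)).toLp

end QPAT

end

/-! A function in `W^{1,2}(Ω)` is identified with the pair (function, weak gradient) in the Hilbert
space `L2Pair Ω`. There `sobolev` and `sobolevZero` are closed subspaces, and the weak form of the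
equation is a bounded bilinear form, coercive with constant `a`. Lax–Milgram on `sobolevZero`,
shifted by a function with trace `g`, gives existence. Continuity and uniqueness both come from the
energy estimate `mul_norm_sub_le`: testing with `u - u₀` gives `a ‖u - u₀‖ ≤ ‖(D - D₀) ∇u₀‖ + ‖(μ -
μ₀) u₀‖`. On the right only the coefficients vary, while `u₀` is fixed. Convergence of coefficients
in `L^p` gives a.e. convergence along subsequences, and the uniform bounds allow dominated
convergence (`continuous_mulL2_admissible`). The argument is the same for every `p ≥ 1`, which
covers both topologies. -/

noncomputable section

namespace QPAT

/-! ### Multiplication operators on `L²` -/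

section Multiplication

variable {α E : Type*} [MeasurableSpace α] {ν : Measure α} [NormedAddCommGroup E]
  [InnerProductSpace ℝ E]

/-- Multiplication by a bounded function, as an operator on `L²`. -/
def mulL2 (E : Type*) [NormedAddCommGroup E] [InnerProductSpace ℝ E] {m : α → ℝ}
    (hm : MemLp m ∞ ν) : Lp E 2 ν →L[ℝ] Lp E 2 ν :=
  (ContinuousLinearMap.lsmul ℝ ℝ).holderL ν ∞ 2 2 hm.toLp

theorem coeFn_mulL2 {m : α → ℝ} (hm : MemLp m ∞ ν) (h : Lp E 2 ν) :
    mulL2 E hm h =ᵐ[ν] fun x => m x • h x := by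
  have h1 := (ContinuousLinearMap.lsmul ℝ ℝ (E := E)).coeFn_holder (r := 2) hm.toLp h
  filter_upwards [h1, hm.coeFn_toLp] with x hx hx'
  simpa [mulL2, hx'] using hx

theorem norm_mulL2_le {m : α → ℝ} (hm : MemLp m ∞ ν) {C : ℝ} (hC : ∀ᵐ x ∂ν, |m x| ≤ C)
    (h : Lp E 2 ν) : ‖mulL2 E hm h‖ ≤ C * ‖h‖ := by
  apply Lp.norm_le_mul_norm_of_ae_le_mul
  filter_upwards [coeFn_mulL2 hm h, hC] with x hx hx'
  rw [hx, norm_smul, Real.norm_eq_abs]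
  gcongr

theorem inner_mulL2 {m : α → ℝ} (hm : MemLp m ∞ ν) (h k : Lp E 2 ν) :
    inner ℝ (mulL2 E hm h) k = ∫ x, m x * inner ℝ (h x) (k x) ∂ν := by
  rw [L2.inner_def]
  apply integral_congr_ae
  filter_upwards [coeFn_mulL2 hm h] with x hx
  rw [hx, real_inner_smul_left]

theorem le_inner_mulL2_self {m : α → ℝ} (hm : MemLp m ∞ ν) {a : ℝ} (ha : ∀ᵐ x ∂ν, a ≤ m x)
    (h : Lp E 2 ν) : a * ‖h‖ ^ 2 ≤ inner ℝ (mulL2 E hm h) h := by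
  rw [← real_inner_self_eq_norm_sq, ← real_inner_smul_left, L2.inner_def, L2.inner_def]
  apply integral_mono_ae (L2.integrable_inner _ _) (L2.integrable_inner _ _)
  filter_upwards [coeFn_mulL2 hm h, ha, Lp.coeFn_smul a h] with x hx hx' hs
  rw [hx, hs, Pi.smul_apply, real_inner_smul_left, real_inner_smul_left]
  exact mul_le_mul_of_nonneg_right hx' real_inner_self_nonneg

/-- Dominated convergence for multiplication operators. -/
theorem tendsto_mulL2_of_ae {m : ℕ → α → ℝ} {m₀ : α → ℝ} (hm : ∀ n, MemLp (m n) ∞ ν)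
    (hm₀ : MemLp m₀ ∞ ν) {C : ℝ} (hC : ∀ n, ∀ᵐ x ∂ν, |m n x| ≤ C) (hC₀ : ∀ᵐ x ∂ν, |m₀ x| ≤ C)
    (hlim : ∀ᵐ x ∂ν, Tendsto (fun n => m n x) atTop (𝓝 (m₀ x))) (h : Lp E 2 ν) :
    Tendsto (fun n => mulL2 E (hm n) h) atTop (𝓝 (mulL2 E hm₀ h)) := by
  rw [Lp.tendsto_Lp_iff_tendsto_eLpNorm']
  have key : Tendsto (fun n => ∫⁻ x, ‖(m n x - m₀ x) • h x‖ₑ ^ (2 : ℝ) ∂ν) atTop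
      (𝓝 (∫⁻ _, 0 ∂ν)) := by
    -- Two functions bounded by `C` differ by at most `2 * C`, so `‖2C h‖²` is an integrable
    -- majorant.
    apply tendsto_lintegral_of_dominated_convergence'
      (fun x => (‖(2 * C) • h x‖ₑ) ^ (2 : ℝ))
    · intro n
      exact ((((hm n).1.sub hm₀.1).smul (Lp.aestronglyMeasurable h)).enorm).pow_const _
    · intro n
      filter_upwards [hC n, hC₀] with x hx hx₀
      gcongr
      have hx' : |m n x - m₀ x| ≤ 2 * C := by
        rw [abs_le] at *
        constructor <;> linarith
      rw [enorm_le_iff_norm_le, norm_smul, norm_smul, Real.norm_eq_abs, Real.norm_eq_abs]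
      exact mul_le_mul_of_nonneg_right (hx'.trans (le_abs_self _)) (norm_nonneg _)
    · have := ((Lp.memLp h).const_smul (2 * C))
      have := lintegral_rpow_enorm_lt_top_of_eLpNorm_lt_top two_ne_zero ENNReal.ofNat_ne_top this.2
      simpa using this.ne
    · filter_upwards [hlim] with x hx
      have : Tendsto (fun n => (m n x - m₀ x) • h x) atTop (𝓝 0) := by
        simpa using (hx.sub_const (m₀ x)).smul_const (h x)
      have := (this.enorm).ennrpow_const 2
      simpa using this
  have key' := key.ennrpow_const (1 / 2)
  simp only [lintegral_zero] at key'
  rw [ENNReal.zero_rpow_of_pos (by norm_num)] at key'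
  refine key'.congr fun n => ?_
  rw [eLpNorm_eq_lintegral_rpow_enorm_toReal two_ne_zero ENNReal.ofNat_ne_top]
  simp only [ENNReal.toReal_ofNat]
  congr 1
  apply lintegral_congr_ae
  filter_upwards [coeFn_mulL2 (hm n) h, coeFn_mulL2 hm₀ h] with x hx hx₀
  rw [Pi.sub_apply, hx, hx₀, sub_smul]

end Multiplication

/-! ### Lax–Milgram on an affine subspace -/

section LaxMilgram

variable {H : Type*} [NormedAddCommGroup H] [InnerProductSpace ℝ H] [CompleteSpace H]

/-- Writing `z = w + v` turns the claim into `B v y = -B w y` on the Hilbert space `V`, where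
Lax–Milgram provides `v`. -/
theorem exists_sub_mem_forall_bilin_eq_zero (B : H →L[ℝ] H →L[ℝ] ℝ) {a : ℝ} (ha : 0 < a)
    (hB : ∀ x, a * ‖x‖ ^ 2 ≤ B x x) (V : Submodule ℝ H) (hV : IsClosed (V : Set H)) (w : H) :
    ∃ z, z - w ∈ V ∧ ∀ y ∈ V, B z y = 0 := by
  have : CompleteSpace V := hV.completeSpace_coe
  have hco : IsCoercive (B.bilinearComp V.subtypeL V.subtypeL) :=
    ⟨a, ha, fun x => by
      have := hB x
      rw [pow_two, ← mul_assoc] at this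
      simpa using this⟩
  let f : V := (InnerProductSpace.toDual ℝ V).symm (-(B w).comp V.subtypeL)
  let v : V := hco.continuousLinearEquivOfBilin.symm f
  refine ⟨w + v, by simp, fun y hy => ?_⟩
  have h1 := hco.continuousLinearEquivOfBilin_apply v ⟨y, hy⟩
  have h2 : inner ℝ f (⟨y, hy⟩ : V) = -(B w) y := by
    simp only [f, InnerProductSpace.toDual_symm_apply]
    simp
  rw [ContinuousLinearEquiv.apply_symm_apply, h2] at h1
  simp at h1
  simp [← h1]

end LaxMilgram

/-! ### The Sobolev space as a closed subspace of `L²` pairs -/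

variable {N : ℕ} {Ω : Set (Space N)}

/-- Pairs of a function and a vector field in `L²(Ω)`. -/
abbrev L2Pair (Ω : Set (Space N)) : Type :=
  WithLp 2 (Lp ℝ 2 (volume.restrict Ω) × Lp (Space N) 2 (volume.restrict Ω))

section WeakGradient

theorem memLp_of_contDiff {φ : Space N → ℝ} (hφ : ContDiff ℝ ∞ φ) (hc : HasCompactSupport φ) :
    MemLp φ 2 (volume.restrict Ω) :=
  (hφ.continuous.memLp_of_hasCompactSupport hc).restrict Ω

theorem continuous_gradient {φ : Space N → ℝ} (hφ : ContDiff ℝ ∞ φ) : Continuous (gradient φ) :=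
  (InnerProductSpace.toDual ℝ (Space N)).symm.continuous.comp (hφ.continuous_fderiv (by simp))

theorem memLp_gradient_of_contDiff {φ : Space N → ℝ} (hφ : ContDiff ℝ ∞ φ)
    (hc : HasCompactSupport φ) : MemLp (gradient φ) 2 (volume.restrict Ω) := by
  have h2 : HasCompactSupport (gradient φ) :=
    (hc.fderiv ℝ).comp_left (g := (InnerProductSpace.toDual ℝ (Space N)).symm) (map_zero _)
  exact ((continuous_gradient hφ).memLp_of_hasCompactSupport h2).restrict Ω

/-- The functional on `L²` pairs whose vanishing for all test functions expresses that the second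
component is the weak gradient of the first. -/
def weakGradientDefect (Ω : Set (Space N)) {φ : Space N → ℝ} (hφ : ContDiff ℝ ∞ φ)
    (hc : HasCompactSupport φ) : L2Pair Ω →L[ℝ] Space N :=
  (((ContinuousLinearMap.lsmul ℝ ℝ).lpPairing (volume.restrict Ω) 2 2).flip
      (memLp_gradient_of_contDiff hφ hc).toLp).comp (WithLp.fstL 2 ℝ _ _) +
    ((ContinuousLinearMap.lsmul ℝ ℝ).lpPairing (volume.restrict Ω) 2 2
      (memLp_of_contDiff hφ hc).toLp).comp (WithLp.sndL 2 ℝ _ _)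

theorem weakGradientDefect_apply {φ : Space N → ℝ} (hφ : ContDiff ℝ ∞ φ)
    (hc : HasCompactSupport φ) (z : L2Pair Ω) :
    weakGradientDefect Ω hφ hc z =
      (∫ x in Ω, z.fst x • gradient φ x) + ∫ x in Ω, φ x • z.snd x := by
  have h1 : weakGradientDefect Ω hφ hc z =
      (ContinuousLinearMap.lsmul ℝ ℝ).lpPairing (volume.restrict Ω) 2 2 z.fst
        (memLp_gradient_of_contDiff hφ hc).toLp +
      (ContinuousLinearMap.lsmul ℝ ℝ).lpPairing (volume.restrict Ω) 2 2
        (memLp_of_contDiff hφ hc).toLp z.snd := rfl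
  rw [h1, ContinuousLinearMap.lpPairing_eq_integral, ContinuousLinearMap.lpPairing_eq_integral]
  congr 1
  · apply integral_congr_ae
    filter_upwards [(memLp_gradient_of_contDiff (Ω := Ω) hφ hc).coeFn_toLp] with x hx
    simp [hx]
  · apply integral_congr_ae
    filter_upwards [(memLp_of_contDiff (Ω := Ω) hφ hc).coeFn_toLp] with x hx
    simp [hx]

/-- The Sobolev space `W^{1,2}(Ω)`, as the space of pairs of a function and its weak gradient. -/
def sobolev (Ω : Set (Space N)) : Submodule ℝ (L2Pair Ω) :=
  ⨅ (φ : Space N → ℝ) (hφ : ContDiff ℝ ∞ φ) (hc : HasCompactSupport φ) (_ : tsupport φ ⊆ Ω),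
    (weakGradientDefect Ω hφ hc).ker

theorem isClosed_sobolev : IsClosed (sobolev Ω : Set (L2Pair Ω)) := by
  simp only [sobolev, Submodule.coe_iInf]
  exact isClosed_iInter fun φ => isClosed_iInter fun hφ => isClosed_iInter fun hc =>
    isClosed_iInter fun _ => (weakGradientDefect Ω hφ hc).isClosed_ker

theorem mem_sobolev_iff {z : L2Pair Ω} : z ∈ sobolev Ω ↔ MemW12 Ω z.fst z.snd := by
  have : z ∈ sobolev Ω ↔ HasWeakGradient Ω z.fst z.snd := by
    simp only [sobolev, Submodule.mem_iInf, HasWeakGradient]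
    refine forall_congr' fun φ => forall_congr' fun hφ => forall_congr' fun hc =>
      forall_congr' fun _ => ?_
    rw [← add_eq_zero_iff_eq_neg, ← weakGradientDefect_apply hφ hc]
    rfl
  rw [this]
  exact ⟨fun h => ⟨Lp.memLp _, Lp.memLp _, h⟩, fun h => h.3⟩

theorem MemW12.congr {w w' : Space N → ℝ} {F F' : Space N → Space N} (h : MemW12 Ω w F)
    (hw : w =ᵐ[volume.restrict Ω] w') (hF : F =ᵐ[volume.restrict Ω] F') : MemW12 Ω w' F' := by
  refine ⟨h.1.ae_eq hw, h.2.ae_eq hF, fun φ h1 h2 h3 => ?_⟩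
  have e1 : ∫ x in Ω, w' x • gradient φ x = ∫ x in Ω, w x • gradient φ x := by
    apply integral_congr_ae
    filter_upwards [hw] with x hx
    rw [hx]
  have e2 : ∫ x in Ω, φ x • F' x = ∫ x in Ω, φ x • F x := by
    apply integral_congr_ae
    filter_upwards [hF] with x hx
    rw [hx]
  rw [e1, e2]
  exact h.3 φ h1 h2 h3

/-- The element of `L2Pair Ω` given by a function and its weak gradient. -/
def MemW12.toPair {w : Space N → ℝ} {F : Space N → Space N} (h : MemW12 Ω w F) : L2Pair Ω :=
  WithLp.toLp 2 (h.memLp.toLp, h.memLp_gradient.toLp)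

theorem MemW12.toPair_fst {w : Space N → ℝ} {F : Space N → Space N} (h : MemW12 Ω w F) :
    h.toPair.fst =ᵐ[volume.restrict Ω] w := h.memLp.coeFn_toLp

theorem MemW12.toPair_snd {w : Space N → ℝ} {F : Space N → Space N} (h : MemW12 Ω w F) :
    h.toPair.snd =ᵐ[volume.restrict Ω] F := h.memLp_gradient.coeFn_toLp

theorem MemW12.toPair_mem {w : Space N → ℝ} {F : Space N → Space N} (h : MemW12 Ω w F) :
    h.toPair ∈ sobolev Ω :=
  mem_sobolev_iff.2 (h.congr h.toPair_fst.symm h.toPair_snd.symm)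

/-- Fundamental lemma of the calculus of variations, applied to `F - F'`. It is needed because
`HasTrace` and `IsWeakSolution` each quantify over their own weak gradient. -/
theorem MemW12.ae_unique (hΩ : IsOpen Ω) {w : Space N → ℝ} {F F' : Space N → Space N}
    (h : MemW12 Ω w F) (h' : MemW12 Ω w F') : F =ᵐ[volume.restrict Ω] F' := by
  have hint : LocallyIntegrableOn (fun x => F x - F' x) Ω := by
    have := (h.2.sub h'.2).locallyIntegrable (by norm_num)
    exact locallyIntegrableOn_of_locallyIntegrable_restrict this
  have := hΩ.ae_eq_zero_of_integral_contDiff_smul_eq_zero hint fun φ h1 h2 h3 => by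
    rw [← setIntegral_eq_integral_of_forall_compl_eq_zero (s := Ω)]
    · have e1 := h.3 φ h1 h2 h3
      have e2 := h'.3 φ h1 h2 h3
      simp only [smul_sub]
      rw [integral_sub, ← neg_inj, neg_sub, sub_eq_neg_add, ← e1, e2]
      · simp
      · exact memLp_one_iff_integrable.1 (h.2.smul (memLp_of_contDiff h1 h2))
      · exact memLp_one_iff_integrable.1 (h'.2.smul (memLp_of_contDiff h1 h2))
    · intro x hx
      rw [image_eq_zero_of_notMem_tsupport fun hx' => hx (h3 hx'), zero_smul]
  rw [EventuallyEq, ae_restrict_iff' hΩ.measurableSet]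
  filter_upwards [this] with x hx hxΩ
  exact sub_eq_zero.1 (hx hxΩ)

end WeakGradient

/-! ### Traces and the space `W^{1,2}_0(Ω)` -/

section Trace

/-- The pair `(w, F)` is approximated arbitrarily well, in `L²(Ω)`, by smooth functions and their
gradients whose boundary values approximate `g`. -/
def ApproxTrace (Ω : Set (Space N)) (w : Space N → ℝ) (F : Space N → Space N)
    (g : Space N → ℝ) : Prop :=
  ∀ ε : ℝ≥0∞, 0 < ε → ∃ φ : Space N → ℝ, ContDiff ℝ ∞ φ ∧
    eLpNorm (fun x => φ x - w x) 2 (volume.restrict Ω) ≤ ε ∧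
    eLpNorm (fun x => gradient φ x - F x) 2 (volume.restrict Ω) ≤ ε ∧
    eLpNorm (fun x => φ x - g x) 2 (surfaceMeasure Ω) ≤ ε

/-- The `ε`-form makes sums and limits a matter of splitting `ε`, with no diagonal sequences. -/
theorem hasTrace_iff {w g : Space N → ℝ} :
    HasTrace Ω w g ↔ ∃ F, MemW12 Ω w F ∧ ApproxTrace Ω w F g := by
  refine exists_congr fun F => and_congr_right fun _ => ⟨?_, fun h => ?_⟩
  · rintro ⟨φ, h0, h1, h2, h3⟩ ε hε
    obtain ⟨n, h1, h2, h3⟩ := ((h1.eventually (ge_mem_nhds hε)).and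
      ((h2.eventually (ge_mem_nhds hε)).and (h3.eventually (ge_mem_nhds hε)))).exists
    exact ⟨φ n, h0 n, h1, h2, h3⟩
  -- For `n = 0` the tolerance is `∞`, which is harmless.
  · choose φ h0 h1 h2 h3 using fun n : ℕ => h ((n : ℝ≥0∞)⁻¹) (by simp)
    have := ENNReal.tendsto_inv_nat_nhds_zero
    exact ⟨φ, h0, tendsto_of_tendsto_of_tendsto_of_le_of_le tendsto_const_nhds this
      (fun _ => zero_le) h1, tendsto_of_tendsto_of_tendsto_of_le_of_le tendsto_const_nhds this
      (fun _ => zero_le) h2, tendsto_of_tendsto_of_tendsto_of_le_of_le tendsto_const_nhds this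
      (fun _ => zero_le) h3⟩

theorem gradient_add {φ ψ : Space N → ℝ} (hφ : ContDiff ℝ ∞ φ) (hψ : ContDiff ℝ ∞ ψ)
    (x : Space N) : gradient (fun x => φ x + ψ x) x = gradient φ x + gradient ψ x := by
  rw [gradient, gradient, gradient, ← map_add]
  congr 1
  exact fderiv_fun_add (hφ.differentiable (by simp) x) (hψ.differentiable (by simp) x)

theorem gradient_const_mul {φ : Space N → ℝ} (hφ : ContDiff ℝ ∞ φ) (c : ℝ)
    (x : Space N) : gradient (fun x => c * φ x) x = c • gradient φ x := by
  rw [gradient, gradient, ← map_smul]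
  congr 1
  exact fderiv_const_mul (hφ.differentiable (by simp) x) c

theorem ApproxTrace.congr {w w' g : Space N → ℝ} {F F' : Space N → Space N}
    (h : ApproxTrace Ω w F g) (hw : w =ᵐ[volume.restrict Ω] w')
    (hF : F =ᵐ[volume.restrict Ω] F') : ApproxTrace Ω w' F' g := by
  intro ε hε
  obtain ⟨φ, h0, h1, h2, h3⟩ := h ε hε
  refine ⟨φ, h0, (eLpNorm_congr_ae ?_).trans_le h1, (eLpNorm_congr_ae ?_).trans_le h2, h3⟩
  · filter_upwards [hw] with x hx
    rw [hx]
  · filter_upwards [hF] with x hx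
    rw [hx]

theorem ApproxTrace.add {w w' g g' : Space N → ℝ} {F F' : Space N → Space N}
    (h : ApproxTrace Ω w F g) (h' : ApproxTrace Ω w' F' g')
    (hw : AEStronglyMeasurable w (volume.restrict Ω))
    (hw' : AEStronglyMeasurable w' (volume.restrict Ω))
    (hF : AEStronglyMeasurable F (volume.restrict Ω))
    (hF' : AEStronglyMeasurable F' (volume.restrict Ω))
    (hg : AEStronglyMeasurable g (surfaceMeasure Ω))
    (hg' : AEStronglyMeasurable g' (surfaceMeasure Ω)) :
    ApproxTrace Ω (w + w') (F + F') (g + g') := by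
  have sub_add {E : Type} [NormedAddCommGroup E] {ν : Measure (Space N)} {p p' q q' : Space N → E}
      {ε : ℝ≥0∞} (hp : AEStronglyMeasurable p ν) (hp' : AEStronglyMeasurable p' ν)
      (hq : AEStronglyMeasurable q ν) (hq' : AEStronglyMeasurable q' ν)
      (hpq : eLpNorm (fun x => p x - q x) 2 ν ≤ ε / 2)
      (hpq' : eLpNorm (fun x => p' x - q' x) 2 ν ≤ ε / 2) :
      eLpNorm (fun x => p x + p' x - (q + q') x) 2 ν ≤ ε := by
    have e : (fun x => p x + p' x - (q + q') x) = (fun x => p x - q x) + fun x => p' x - q' x := by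
      ext x
      simp only [Pi.add_apply]
      abel
    rw [e]
    refine (eLpNorm_add_le (hp.sub hq) (hp'.sub hq') one_le_two).trans ?_
    exact (add_le_add hpq hpq').trans (ENNReal.add_halves ε).le
  intro ε hε
  obtain ⟨φ, h0, h1, h2, h3⟩ := h (ε / 2) (ENNReal.half_pos hε.ne')
  obtain ⟨φ', h0', h1', h2', h3'⟩ := h' (ε / 2) (ENNReal.half_pos hε.ne')
  refine ⟨fun x => φ x + φ' x, h0.add h0', ?_, ?_, ?_⟩
  · exact sub_add h0.continuous.aestronglyMeasurable h0'.continuous.aestronglyMeasurable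
      hw hw' h1 h1'
  · simp only [gradient_add h0 h0']
    exact sub_add (continuous_gradient h0).aestronglyMeasurable
      (continuous_gradient h0').aestronglyMeasurable hF hF' h2 h2'
  · exact sub_add h0.continuous.aestronglyMeasurable h0'.continuous.aestronglyMeasurable
      hg hg' h3 h3'

theorem ApproxTrace.const_smul {w g : Space N → ℝ} {F : Space N → Space N}
    (h : ApproxTrace Ω w F g) (c : ℝ) : ApproxTrace Ω (c • w) (c • F) (c • g) := by
  have mul_le {E : Type} [NormedAddCommGroup E] [NormedSpace ℝ E] {ν : Measure (Space N)}
      {p q : Space N → E} {ε : ℝ≥0∞} (hpq : eLpNorm (fun x => p x - q x) 2 ν ≤ ε / ‖c‖ₑ) :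
      eLpNorm (fun x => c • p x - (c • q) x) 2 ν ≤ ε := by
    have e : (fun x => c • p x - (c • q) x) = c • fun x => p x - q x := by
      ext x
      simp only [Pi.smul_apply, smul_sub]
    rw [e, eLpNorm_const_smul]
    exact (mul_le_mul_right hpq _).trans ENNReal.mul_div_le
  intro ε hε
  -- For `c = 0` the tolerance is `∞`, and `0 * ∞ = 0` keeps the bound valid.
  obtain ⟨φ, h0, h1, h2, h3⟩ := h (ε / ‖c‖ₑ) (ENNReal.div_pos hε.ne' enorm_ne_top)
  refine ⟨fun x => c * φ x, contDiff_const.mul h0, mul_le h1, ?_, mul_le h3⟩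
  simp only [gradient_const_mul h0]
  exact mul_le h2

theorem approxTrace_zero : ApproxTrace Ω 0 0 0 := fun ε _ =>
  ⟨fun _ => 0, contDiff_const, by simp, by simp [gradient], by simp⟩

/-- The boundary datum stays fixed, so the triangle inequality is needed only for the two norms over
`Ω`. This makes `sobolevZero` closed, hence complete as Lax–Milgram requires. -/
theorem ApproxTrace.of_approx {z : L2Pair Ω} {g : Space N → ℝ}
    (h : ∀ ε : ℝ≥0∞, 0 < ε → ∃ y : L2Pair Ω, edist y z ≤ ε ∧ ApproxTrace Ω y.fst y.snd g) :
    ApproxTrace Ω z.fst z.snd g := by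
  have tri {E : Type} [NormedAddCommGroup E] {ν : Measure (Space N)} {p : Space N → E}
      {q r : Lp E 2 ν} {ε : ℝ≥0∞} (hp : AEStronglyMeasurable p ν)
      (hpq : eLpNorm (fun x => p x - q x) 2 ν ≤ ε / 2) (hqr : edist q r ≤ ε / 2) :
      eLpNorm (fun x => p x - r x) 2 ν ≤ ε := by
    have e : (fun x => p x - r x) = (fun x => p x - q x) + (⇑q - ⇑r) := by
      ext x
      simp
    rw [Lp.edist_def] at hqr
    rw [e]
    refine (eLpNorm_add_le (hp.sub (Lp.aestronglyMeasurable q))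
      ((Lp.aestronglyMeasurable q).sub (Lp.aestronglyMeasurable r)) one_le_two).trans ?_
    exact (add_le_add hpq hqr).trans (ENNReal.add_halves ε).le
  intro ε hε
  obtain ⟨y, hy, hyt⟩ := h (ε / 2) (ENNReal.half_pos hε.ne')
  obtain ⟨φ, h0, h1, h2, h3⟩ := hyt (ε / 2) (ENNReal.half_pos hε.ne')
  exact ⟨φ, h0,
    tri h0.continuous.aestronglyMeasurable h1 ((WithLp.edist_fst_le y z).trans hy),
    tri (continuous_gradient h0).aestronglyMeasurable h2 ((WithLp.edist_snd_le y z).trans hy),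
    h3.trans ENNReal.half_le_self⟩

theorem approxTrace_add {y z : L2Pair Ω} {g g' : Space N → ℝ}
    (hy : ApproxTrace Ω y.fst y.snd g) (hz : ApproxTrace Ω z.fst z.snd g')
    (hg : AEStronglyMeasurable g (surfaceMeasure Ω))
    (hg' : AEStronglyMeasurable g' (surfaceMeasure Ω)) :
    ApproxTrace Ω (y + z).fst (y + z).snd (g + g') :=
  (hy.add hz (Lp.aestronglyMeasurable _) (Lp.aestronglyMeasurable _) (Lp.aestronglyMeasurable _)
    (Lp.aestronglyMeasurable _) hg hg').congr (Lp.coeFn_add _ _).symm (Lp.coeFn_add _ _).symm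

theorem approxTrace_smul {z : L2Pair Ω} {g : Space N → ℝ}
    (hz : ApproxTrace Ω z.fst z.snd g) (c : ℝ) :
    ApproxTrace Ω (c • z).fst (c • z).snd (c • g) :=
  (hz.const_smul c).congr (Lp.coeFn_smul _ _).symm (Lp.coeFn_smul _ _).symm

/-- The space `W^{1,2}_0(Ω)` of functions in `W^{1,2}(Ω)` with vanishing trace. -/
def sobolevZero (Ω : Set (Space N)) : Submodule ℝ (L2Pair Ω) where
  carrier := {z | z ∈ sobolev Ω ∧ ApproxTrace Ω z.fst z.snd 0}
  zero_mem' := ⟨zero_mem _, approxTrace_zero.congr (Lp.coeFn_zero _ _ _).symm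
    (Lp.coeFn_zero _ _ _).symm⟩
  add_mem' hy hz := ⟨add_mem hy.1 hz.1, by
    simpa using approxTrace_add hy.2 hz.2 aestronglyMeasurable_zero aestronglyMeasurable_zero⟩
  smul_mem' c _ hz := ⟨Submodule.smul_mem _ c hz.1, by simpa using approxTrace_smul hz.2 c⟩

theorem isClosed_sobolevZero : IsClosed (sobolevZero Ω : Set (L2Pair Ω)) := by
  refine isClosed_of_closure_subset fun z hz => ⟨?_, ApproxTrace.of_approx fun ε hε => ?_⟩
  · exact closure_minimal (fun y (hy : y ∈ sobolevZero Ω) => hy.1) isClosed_sobolev hz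
  · obtain ⟨y, hy, hyz⟩ := EMetric.mem_closure_iff.1 hz ε hε
    exact ⟨y, (edist_comm z y ▸ hyz).le, hy.2⟩

end Trace

/-! ### Weak solutions: existence, uniqueness, stability -/

section WeakSolution

/-- The bilinear form `(z, y) ↦ ∫ D ∇z · ∇y + ∫ μ z y` of the diffusion equation. -/
def diffusionForm {μ D : Space N → ℝ} (hμ : MemLp μ ∞ (volume.restrict Ω))
    (hD : MemLp D ∞ (volume.restrict Ω)) : L2Pair Ω →L[ℝ] L2Pair Ω →L[ℝ] ℝ :=
  (innerSL ℝ).bilinearComp ((mulL2 (Space N) hD).comp (WithLp.sndL 2 ℝ _ _))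
      (WithLp.sndL 2 ℝ _ _) +
    (innerSL ℝ).bilinearComp ((mulL2 ℝ hμ).comp (WithLp.fstL 2 ℝ _ _)) (WithLp.fstL 2 ℝ _ _)

variable {μ D : Space N → ℝ} (hμ : MemLp μ ∞ (volume.restrict Ω))
  (hD : MemLp D ∞ (volume.restrict Ω))

theorem diffusionForm_apply (z y : L2Pair Ω) :
    diffusionForm hμ hD z y =
      inner ℝ (mulL2 (Space N) hD z.snd) y.snd + inner ℝ (mulL2 ℝ hμ z.fst) y.fst := rfl

theorem diffusionForm_eq_integral {z y : L2Pair Ω} {u v : Space N → ℝ} {F V : Space N → Space N}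
    (hu : z.fst =ᵐ[volume.restrict Ω] u) (hF : z.snd =ᵐ[volume.restrict Ω] F)
    (hv : y.fst =ᵐ[volume.restrict Ω] v) (hV : y.snd =ᵐ[volume.restrict Ω] V) :
    diffusionForm hμ hD z y =
      (∫ x in Ω, D x * inner ℝ (F x) (V x)) + ∫ x in Ω, μ x * u x * v x := by
  rw [diffusionForm_apply, inner_mulL2, inner_mulL2]
  congr 1 <;> apply integral_congr_ae
  · filter_upwards [hF, hV] with x h1 h2
    rw [h1, h2]
  · filter_upwards [hu, hv] with x h1 h2
    rw [h1, h2, mul_assoc, RCLike.inner_apply, conj_trivial, mul_comm (v x)]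

/-- The absorption term controls the function and the diffusion term its gradient, so no Poincaré
inequality is needed. -/
theorem le_diffusionForm_self {a : ℝ} (hμa : ∀ᵐ x ∂(volume.restrict Ω), a ≤ μ x)
    (hDa : ∀ᵐ x ∂(volume.restrict Ω), a ≤ D x) (z : L2Pair Ω) :
    a * ‖z‖ ^ 2 ≤ diffusionForm hμ hD z z := by
  rw [diffusionForm_apply, WithLp.prod_norm_sq_eq_of_L2]
  linarith [le_inner_mulL2_self hμ hμa z.fst, le_inner_mulL2_self hD hDa z.snd]

theorem isWeakSolution_iff (hΩ : IsOpen Ω) {g : Space N → ℝ} {u : Lp ℝ 2 (volume.restrict Ω)} :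
    IsWeakSolution Ω g μ D u ↔ ∃ z ∈ sobolev Ω, z.fst = u ∧ ApproxTrace Ω z.fst z.snd g ∧
      ∀ y ∈ sobolevZero Ω, diffusionForm hμ hD z y = 0 := by
  constructor
  · rintro ⟨ht, F, hF, hsol⟩
    obtain ⟨F', hF', ht⟩ := hasTrace_iff.1 ht
    refine ⟨hF.toPair, hF.toPair_mem, Lp.ext hF.toPair_fst, ht.congr hF.toPair_fst.symm
      ((hF'.ae_unique hΩ hF).trans hF.toPair_snd.symm), fun y hy => ?_⟩
    rw [diffusionForm_eq_integral hμ hD hF.toPair_fst hF.toPair_snd .rfl .rfl]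
    have hy' := mem_sobolev_iff.1 hy.1
    exact hsol _ _ hy' (hasTrace_iff.2 ⟨_, hy', hy.2⟩)
  · rintro ⟨z, hz, rfl, ht, hsol⟩
    have hz' := mem_sobolev_iff.1 hz
    refine ⟨hasTrace_iff.2 ⟨_, hz', ht⟩, _, hz', fun v V hv htv => ?_⟩
    obtain ⟨V', hV', htv⟩ := hasTrace_iff.1 htv
    rw [← diffusionForm_eq_integral hμ hD .rfl .rfl hv.toPair_fst hv.toPair_snd]
    exact hsol _ ⟨hv.toPair_mem, htv.congr hv.toPair_fst.symm
      ((hV'.ae_unique hΩ hv).trans hv.toPair_snd.symm)⟩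

theorem sub_mem_sobolevZero {g : Space N → ℝ} (hg : AEStronglyMeasurable g (surfaceMeasure Ω))
    {y z : L2Pair Ω} (hy : y ∈ sobolev Ω) (hz : z ∈ sobolev Ω)
    (hyg : ApproxTrace Ω y.fst y.snd g) (hzg : ApproxTrace Ω z.fst z.snd g) :
    y - z ∈ sobolevZero Ω := by
  refine ⟨sub_mem hy hz, ?_⟩
  have := approxTrace_add hyg (approxTrace_smul hzg (-1)) hg (hg.const_smul _)
  simpa [← sub_eq_add_neg] using this

/-- The solution depends Lipschitz continuously on the coefficient operators. -/
theorem mul_norm_sub_le {μ₀ D₀ : Space N → ℝ} (hμ₀ : MemLp μ₀ ∞ (volume.restrict Ω))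
    (hD₀ : MemLp D₀ ∞ (volume.restrict Ω)) {a : ℝ}
    (hμa : ∀ᵐ x ∂(volume.restrict Ω), a ≤ μ x) (hDa : ∀ᵐ x ∂(volume.restrict Ω), a ≤ D x)
    {z z₀ : L2Pair Ω} (hzz : z - z₀ ∈ sobolevZero Ω)
    (hz : ∀ y ∈ sobolevZero Ω, diffusionForm hμ hD z y = 0)
    (hz₀ : ∀ y ∈ sobolevZero Ω, diffusionForm hμ₀ hD₀ z₀ y = 0) :
    a * ‖z - z₀‖ ≤ ‖mulL2 (Space N) hD z₀.snd - mulL2 (Space N) hD₀ z₀.snd‖ +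
      ‖mulL2 ℝ hμ z₀.fst - mulL2 ℝ hμ₀ z₀.fst‖ := by
  rcases (norm_nonneg (z - z₀)).eq_or_lt with h0 | h0
  · rw [← h0, mul_zero]
    positivity
  refine le_of_mul_le_mul_right ?_ h0
  have h1 := le_diffusionForm_self hμ hD hμa hDa (z - z₀)
  -- Since `z` and `z₀` solve their own equations, the form at `z - z₀` equals minus the difference
  -- of the two forms at `z₀`.
  have h2 : diffusionForm hμ hD (z - z₀) (z - z₀) =
      -(inner ℝ (mulL2 (Space N) hD z₀.snd - mulL2 (Space N) hD₀ z₀.snd) (z - z₀).snd +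
        inner ℝ (mulL2 ℝ hμ z₀.fst - mulL2 ℝ hμ₀ z₀.fst) (z - z₀).fst) := by
    have h3 := hz₀ _ hzz
    rw [diffusionForm_apply] at h3
    rw [map_sub (diffusionForm hμ hD), sub_apply, hz _ hzz, diffusionForm_apply, inner_sub_left,
      inner_sub_left]
    linarith
  have h4 := abs_le.1 (abs_real_inner_le_norm
    (mulL2 (Space N) hD z₀.snd - mulL2 (Space N) hD₀ z₀.snd) (z - z₀).snd)
  have h5 := abs_le.1 (abs_real_inner_le_norm
    (mulL2 ℝ hμ z₀.fst - mulL2 ℝ hμ₀ z₀.fst) (z - z₀).fst)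
  have h6 := mul_le_mul_of_nonneg_left (WithLp.norm_snd_le _ (z - z₀))
    (norm_nonneg (mulL2 (Space N) hD z₀.snd - mulL2 (Space N) hD₀ z₀.snd))
  have h7 := mul_le_mul_of_nonneg_left (WithLp.norm_fst_le _ (z - z₀))
    (norm_nonneg (mulL2 ℝ hμ z₀.fst - mulL2 ℝ hμ₀ z₀.fst))
  calc a * ‖z - z₀‖ * ‖z - z₀‖ = a * ‖z - z₀‖ ^ 2 := by ring
    _ ≤ _ := h1
    _ ≤ _ := by rw [h2, add_mul]; linarith [h4.1, h5.1]

theorem existsUnique_isWeakSolution (hΩ : IsOpen Ω) {g : Space N → ℝ}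
    (hg : AEStronglyMeasurable g (surfaceMeasure Ω)) (hgt : ∃ w, HasTrace Ω w g) {a : ℝ}
    (ha : 0 < a) (hμa : ∀ᵐ x ∂(volume.restrict Ω), a ≤ μ x)
    (hDa : ∀ᵐ x ∂(volume.restrict Ω), a ≤ D x) (hμ : MemLp μ ∞ (volume.restrict Ω))
    (hD : MemLp D ∞ (volume.restrict Ω)) :
    ∃! u : Lp ℝ 2 (volume.restrict Ω), IsWeakSolution Ω g μ D u := by
  simp only [isWeakSolution_iff hμ hD hΩ]
  obtain ⟨w, hw⟩ := hgt
  obtain ⟨F, hF, ht⟩ := hasTrace_iff.1 hw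
  obtain ⟨z, hzw, hz⟩ := exists_sub_mem_forall_bilin_eq_zero (diffusionForm hμ hD) ha
    (le_diffusionForm_self hμ hD hμa hDa) (sobolevZero Ω) isClosed_sobolevZero hF.toPair
  refine ⟨z.fst, ⟨z, ?_, rfl, ?_, hz⟩, ?_⟩
  · simpa using add_mem hzw.1 hF.toPair_mem
  · have := approxTrace_add hzw.2 (ht.congr hF.toPair_fst.symm hF.toPair_snd.symm)
      aestronglyMeasurable_zero hg
    simpa using this
  · rintro _ ⟨y, hy, rfl, hyt, hysol⟩
    have hzt := approxTrace_add hzw.2 (ht.congr hF.toPair_fst.symm hF.toPair_snd.symm)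
      aestronglyMeasurable_zero hg
    have hzS := add_mem hzw.1 hF.toPair_mem
    rw [zero_add] at hzt
    rw [sub_add_cancel] at hzt hzS
    -- Uniqueness is the stability estimate with equal coefficients.
    have := mul_norm_sub_le hμ hD hμ hD hμa hDa (sub_mem_sobolevZero hg hy hzS hyt hzt) hysol hz
    rw [sub_self, sub_self, norm_zero, norm_zero, add_zero] at this
    have h0 : ‖y - z‖ = 0 := le_antisymm (by nlinarith [norm_nonneg (y - z)]) (norm_nonneg _)
    rw [sub_eq_zero.1 (norm_eq_zero.1 h0)]

end WeakSolution

/-! ### Continuity of the measurement operator -/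

section Continuity

variable {a b : ℝ} {p : ℝ≥0∞}

theorem ae_abs_le_of_mem_admissible {f : Lp ℝ p (volume.restrict Ω)}
    (hf : f ∈ admissible Ω a b p) : ∀ᵐ x ∂(volume.restrict Ω), |f x| ≤ max |a| |b| := by
  have hf' : ∀ᵐ x ∂(volume.restrict Ω), a ≤ f x ∧ f x ≤ b := hf
  filter_upwards [hf'] with x hx using abs_le_max_abs_abs hx.1 hx.2

theorem memLp_top_of_mem_admissible {f : Lp ℝ p (volume.restrict Ω)}
    (hf : f ∈ admissible Ω a b p) : MemLp f ∞ (volume.restrict Ω) :=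
  memLp_top_of_bound (Lp.aestronglyMeasurable f) _ (ae_abs_le_of_mem_admissible hf)

/-- Continuity is claimed only for a fixed `h`, that is, in the strong operator topology.
Convergence in `L^p` implies convergence in measure, so every subsequence has an a.e. convergent
further one, to which dominated convergence applies. -/
theorem continuous_mulL2_admissible [Fact (1 ≤ p)] {E : Type*} [NormedAddCommGroup E]
    [InnerProductSpace ℝ E] (h : Lp E 2 (volume.restrict Ω)) :
    Continuous fun f : admissible Ω a b p => mulL2 E (memLp_top_of_mem_admissible f.2) h := by
  refine continuous_iff_seqContinuous.2 fun f f₀ hf => tendsto_of_subseq_tendsto fun ns hns => ?_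
  have h1 : Tendsto (fun n => (f (ns n)).1) atTop (𝓝 f₀.1) :=
    (continuous_subtype_val.tendsto f₀).comp (hf.comp hns)
  obtain ⟨ms, -, hms⟩ := (tendstoInMeasure_of_tendsto_Lp h1).exists_seq_tendsto_ae
  exact ⟨ms, tendsto_mulL2_of_ae (fun n => memLp_top_of_mem_admissible (f (ns (ms n))).2)
    (memLp_top_of_mem_admissible f₀.2) (fun n => ae_abs_le_of_mem_admissible (f (ns (ms n))).2)
    (ae_abs_le_of_mem_admissible f₀.2) hms h⟩

theorem measurementOperator_eq {g : Space N → ℝ} (q : admissible Ω a b p × admissible Ω a b p) :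
    measurementOperator Ω g a b p q =
      mulL2 ℝ (memLp_top_of_mem_admissible q.1.2) (fluence Ω g q.1 q.2) :=
  Lp.ext ((MemLp.coeFn_toLp _).trans (coeFn_mulL2 _ _).symm)

theorem continuous_measurementOperator [Fact (1 ≤ p)] (hΩ : IsOpen Ω) {g : Space N → ℝ}
    (hg : AEStronglyMeasurable g (surfaceMeasure Ω)) (hgt : ∃ w, HasTrace Ω w g) (ha : 0 < a) :
    Continuous (measurementOperator Ω g a b p) := by
  have lower (f : admissible Ω a b p) : ∀ᵐ x ∂(volume.restrict Ω), a ≤ f.1 x := by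
    have hf : ∀ᵐ x ∂(volume.restrict Ω), a ≤ f.1 x ∧ f.1 x ≤ b := f.2
    exact hf.mono fun x hx => hx.1
  have sol (q : admissible Ω a b p × admissible Ω a b p) :
      ∃ z ∈ sobolev Ω, z.fst = fluence Ω g q.1 q.2 ∧ ApproxTrace Ω z.fst z.snd g ∧
        ∀ y ∈ sobolevZero Ω, diffusionForm (memLp_top_of_mem_admissible q.1.2)
          (memLp_top_of_mem_admissible q.2.2) z y = 0 :=
    -- Existence guarantees that the `epsilon` in `fluence` really picks a solution.
    (isWeakSolution_iff _ _ hΩ).1 (Classical.epsilon_spec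
      (existsUnique_isWeakSolution hΩ hg hgt ha (lower q.1) (lower q.2)
        (memLp_top_of_mem_admissible q.1.2) (memLp_top_of_mem_admissible q.2.2)).exists)
  choose z hz hzu hzt hzsol using sol
  have hzcont : Continuous z := by
    refine continuous_iff_continuousAt.2 fun q₀ => ?_
    have hbound (q : admissible Ω a b p × admissible Ω a b p) := mul_norm_sub_le
      (memLp_top_of_mem_admissible q.1.2) (memLp_top_of_mem_admissible q.2.2)
      (memLp_top_of_mem_admissible q₀.1.2) (memLp_top_of_mem_admissible q₀.2.2) (lower q.1) (lower q.2)
      (sub_mem_sobolevZero hg (hz q) (hz q₀) (hzt q) (hzt q₀)) (hzsol q) (hzsol q₀)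
    have c1 := (((continuous_mulL2_admissible (z q₀).snd).comp
      (continuous_snd (X := admissible Ω a b p))).tendsto q₀)
    have c2 := (((continuous_mulL2_admissible (z q₀).fst).comp
      (continuous_fst (Y := admissible Ω a b p))).tendsto q₀)
    have c3 := ((tendsto_iff_norm_sub_tendsto_zero.1 c1).add
      (tendsto_iff_norm_sub_tendsto_zero.1 c2)).const_mul a⁻¹
    rw [add_zero, mul_zero] at c3
    refine tendsto_iff_norm_sub_tendsto_zero.2 (squeeze_zero (fun _ => norm_nonneg _)
      (fun q => ?_) c3)
    rw [le_inv_mul_iff₀ ha]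
    exact hbound q
  refine continuous_iff_continuousAt.2 fun q₀ => tendsto_iff_norm_sub_tendsto_zero.2 ?_
  have c1 := tendsto_iff_norm_sub_tendsto_zero.1 (hzcont.tendsto q₀)
  have c2 := tendsto_iff_norm_sub_tendsto_zero.1 (((continuous_mulL2_admissible (z q₀).fst).comp
    (continuous_fst (Y := admissible Ω a b p))).tendsto q₀)
  have c3 := (c1.const_mul (max |a| |b|)).add c2
  rw [mul_zero, add_zero] at c3
  refine squeeze_zero (fun _ => norm_nonneg _) (fun q => ?_) c3
  rw [measurementOperator_eq, measurementOperator_eq, ← hzu, ← hzu]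
  -- Splitting `μ u - μ₀ u₀ = μ (u - u₀) + (μ - μ₀) u₀`: the first term is handled by the uniform
  -- bound on `μ`, the second has a fixed factor `u₀`.
  refine (norm_sub_le_norm_sub_add_norm_sub _
    (mulL2 ℝ (memLp_top_of_mem_admissible q.1.2) (z q₀).fst) _).trans ?_
  refine add_le_add ?_ le_rfl
  rw [← map_sub]
  refine (norm_mulL2_le _ (ae_abs_le_of_mem_admissible q.1.2) _).trans ?_
  exact mul_le_mul_of_nonneg_left (WithLp.norm_fst_le _ (z q - z q₀)) (by positivity)

end Continuity

end QPAT

end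

theorem mainTheorem3 (N : ℕ) (hN : 1 ≤ N) (Ω : Set (QPAT.Space N))
    (hΩ : QPAT.IsLipschitzDomain Ω) (g : QPAT.Space N → ℝ) (hg : ContinuousOn g (frontier Ω))
    (hg_trace : ∃ w : QPAT.Space N → ℝ, QPAT.HasTrace Ω w g) (a b : ℝ) (ha : 0 < a) :
    (∀ μ D : QPAT.Space N → ℝ,
      AEStronglyMeasurable μ (volume.restrict Ω) → AEStronglyMeasurable D (volume.restrict Ω) →
      (∀ᵐ x ∂(volume.restrict Ω), a ≤ μ x ∧ μ x ≤ b) →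
      (∀ᵐ x ∂(volume.restrict Ω), a ≤ D x ∧ D x ≤ b) →
      ∃! u : Lp ℝ 2 (volume.restrict Ω), QPAT.IsWeakSolution Ω g μ D u) ∧
    Continuous (QPAT.measurementOperator Ω g a b 2) ∧
    Continuous (QPAT.measurementOperator Ω g a b 1) := by
  have hgm : AEStronglyMeasurable g (QPAT.surfaceMeasure Ω) :=
    hg.aestronglyMeasurable isClosed_frontier.measurableSet
  refine ⟨fun μ D hμm hDm hμ hD => ?_,
    QPAT.continuous_measurementOperator hΩ.isOpen hgm hg_trace ha,
    QPAT.continuous_measurementOperator hΩ.isOpen hgm hg_trace ha⟩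
  have bound {m : QPAT.Space N → ℝ} (hm : AEStronglyMeasurable m (volume.restrict Ω))
      (h : ∀ᵐ x ∂(volume.restrict Ω), a ≤ m x ∧ m x ≤ b) : MemLp m ∞ (volume.restrict Ω) :=
    memLp_top_of_bound hm (max |a| |b|)
      (h.mono fun x hx => abs_le_max_abs_abs hx.1 hx.2)
  exact QPAT.existsUnique_isWeakSolution hΩ.isOpen hgm hg_trace ha
    (hμ.mono fun x hx => hx.1) (hD.mono fun x hx => hx.1) (bound hμm hμ) (bound hDm hD)
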